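/- Let $d\ge 0$ and let $\gamma$ be the standard Gaussian distribution on $\mathbb{R}^d$. Let $\mathcal{P}_2(\mathbb{R}^d)$ be the set of probability measures on $\mathbb{R}^d$ with finite second moment and $\mathcal{P}_2^x(\mathbb{R}^d)$ the subset of those with barycenter $x$. For $p_1,p_2\in\mathcal{P}_2(\mathbb{R}^d)$ put $\mathrm{MCov}(p_1,p_2)=\sup_q\int\langle x_1,x_2\rangle\,q(dx_1,dx_2)$, the supremum over all couplings $q$ of $p_1$ and $p_2$. Let $C_q(\mathbb{R}^d)$ be the set of continuous $\psi:\mathbb{R}^d\to\mathbb{R}$ for which there are $a,k,\ell\in\mathbb{R}$ with $\ell+\tfrac12|x|^2\le\psi(x)\le a+k|x|^2$ for all $x$. For $\psi\in C_q(\mathbb{R}^d)$ put $$\varphi^\psi(x)=\inf_{p\in\mathcal{P}_2^x(\mathbb{R}^d)}\Big(\int\psi\,dp-\mathrm{MCov}(p,\gamma)\Big),\qquad x\in\mathbb{R}^d.$$ For $f:\mathbb{R}^d\to[-\infty,+\infty]$ write $f^*(y)=\sup_{x}(\langle x,y\rangle-f(x))$ for its convex conjugate, and $(f*\gamma)(x)=\int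 f(x-y)\,\gamma(dy)$ for its convolution with $\gamma$ whenever this integral is well defined in $[-\infty,+\infty]$. Let $\mu,\nu\in\mathcal{P}_2(\mathbb{R}^d)$ be in convex order, $\mu\preceq_c\nu$, i.e. $\int\phi\,d\mu\le\int\phi\,d\nu$ for every convex $\phi:\mathbb{R}^d\to\mathbb{R}$ of linear growth. Then $$\inf_{\psi\in C_q(\mathbb{R}^d)}\Big(\int\psi\,d\nu-\int\varphi^\psi\,d\mu\Big)=\inf_{\psi}\Big(\int\psi\,d\nu-\int(\psi^* *\gamma)^*\,d\mu\Big),$$ where the infimum on the right is over all convex $\psi:\mathbb{R}^d\to(-\infty,+\infty]$ in $L^1(\nu)$, and $\int(\psi^**\gamma)^*\,d\mu$ is an integral with values in $[-\infty,+\infty)$. Moreover, for every convex $\psi\in C_q(\mathbb{R}^d)$ and every $x\in\mathbb{R}^d$, $\varphi^\psi(x)=(\psi^**\gamma)^*(x)$. -/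

import Mathlib

open MeasureTheory ProbabilityTheory

namespace WeakMartingaleDuality

/-- The space `ℝᵈ` with its Euclidean norm and inner product. -/
abbrev E (d : ℕ) : Type := EuclideanSpace ℝ (Fin d)

/-- The standard Gaussian distribution `γ` on `ℝᵈ`. -/
noncomputable abbrev gam (d : ℕ) : Measure (E d) := stdGaussian (E d)

/-- The class `𝒫₂(ℝᵈ)` of probability measures with finite second moment. -/
def IsP2 {d : ℕ} (p : Measure (E d)) : Prop :=
  IsProbabilityMeasure p ∧ Integrable (fun x => ‖x‖ ^ 2) p

/-- The class `𝒫₂ˣ(ℝᵈ)` of measures in `𝒫₂(ℝᵈ)` with barycenter `x`. -/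
def IsP2At {d : ℕ} (x : E d) (p : Measure (E d)) : Prop :=
  IsP2 p ∧ ∫ y, y ∂p = x

/-- Convex order: `∫ φ dμ ≤ ∫ φ dν` for all convex `φ : ℝᵈ → ℝ` of linear growth.
(On `𝒫₂(ℝᵈ)` these integrals are finite.) -/
def ConvexOrder {d : ℕ} (μ ν : Measure (E d)) : Prop :=
  ∀ φ : E d → ℝ, ConvexOn ℝ Set.univ φ → (∃ C : ℝ, ∀ x, |φ x| ≤ C * (1 + ‖x‖)) →
    ∫ x, φ x ∂μ ≤ ∫ x, φ x ∂ν

/-- `q` is a coupling of `p₁` and `p₂`. If `p₁` is a probability measure, so is `q`. -/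
def IsCoupling {d : ℕ} (p₁ p₂ : Measure (E d)) (q : Measure (E d × E d)) : Prop :=
  q.map Prod.fst = p₁ ∧ q.map Prod.snd = p₂

/-- Maximal covariance of `p₁` and `p₂`. For `p₁, p₂ ∈ 𝒫₂(ℝᵈ)` the inner product is integrable
under every coupling. -/
noncomputable def MCov {d : ℕ} (p₁ p₂ : Measure (E d)) : EReal :=
  ⨆ q : {q : Measure (E d × E d) // IsCoupling p₁ p₂ q},
    ((∫ z, inner ℝ z.1 z.2 ∂q.1 : ℝ) : EReal)

/-- The integral, with values in `[-∞, +∞]`, of an extended-real-valued function: the integral of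
the positive part minus the integral of the negative part. -/
noncomputable def eint {d : ℕ} (p : Measure (E d)) (f : E d → EReal) : EReal :=
  ((∫⁻ x, (f x).toENNReal ∂p : ENNReal) : EReal) -
    ((∫⁻ x, (-f x).toENNReal ∂p : ENNReal) : EReal)

/-- Membership of an extended-real-valued function in `L¹(p)`. -/
def IsL1 {d : ℕ} (p : Measure (E d)) (f : E d → EReal) : Prop :=
  AEMeasurable f p ∧ ∫⁻ x, (f x).toENNReal ∂p < ⊤ ∧ ∫⁻ x, (-f x).toENNReal ∂p < ⊤

/-- `f` is a convex function with values in `(-∞, +∞]`: it never takes the value `-∞` and its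
epigraph is convex. -/
def IsConvex {d : ℕ} (f : E d → EReal) : Prop :=
  (∀ x, f x ≠ ⊥) ∧ Convex ℝ {z : E d × ℝ | f z.1 ≤ (z.2 : EReal)}

/-- The convex conjugate `f*(y) = sup_x (⟨x, y⟩ - f(x))`. -/
noncomputable def conj {d : ℕ} (f : E d → EReal) (y : E d) : EReal :=
  ⨆ x : E d, ((inner ℝ x y : ℝ) : EReal) - f x

/-- The convolution `(f ∗ p)(x) = ∫ f(x - y) p(dy)` of a function and a measure. -/
noncomputable def conv {d : ℕ} (f : E d → EReal) (p : Measure (E d)) (x : E d) : EReal :=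
  eint p (fun y => f (x - y))

/-- The set `C_q(ℝᵈ)` of continuous functions of quadratic growth. -/
def IsCq {d : ℕ} (ψ : E d → ℝ) : Prop :=
  Continuous ψ ∧ ∃ a k l : ℝ, ∀ x, l + ‖x‖ ^ 2 / 2 ≤ ψ x ∧ ψ x ≤ a + k * ‖x‖ ^ 2

/-- `φ^ψ(x) = inf { ∫ ψ dp - MCov(p, γ) : p ∈ 𝒫₂ˣ(ℝᵈ) }`. -/
noncomputable def phi {d : ℕ} (ψ : E d → EReal) (x : E d) : EReal :=
  ⨅ p : {p : Measure (E d) // IsP2At x p}, eint p.1 ψ - MCov p.1 (gam d)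

/-- The dual value `D̃(μ, ν) = inf { ∫ ψ dν - ∫ φ^ψ dμ : ψ ∈ C_q(ℝᵈ) }`. -/
noncomputable def dualTilde {d : ℕ} (μ ν : Measure (E d)) : EReal :=
  ⨅ ψ : {ψ : E d → ℝ // IsCq ψ},
    eint ν (fun x => (ψ.1 x : EReal)) - eint μ (phi fun x => (ψ.1 x : EReal))

/-- The value `D(μ, ν) = inf { ∫ ψ dν - ∫ (ψ* ∗ γ)* dμ : ψ ∈ L¹(ν) convex }`. -/
noncomputable def dual {d : ℕ} (μ ν : Measure (E d)) : EReal :=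
  ⨅ ψ : {ψ : E d → EReal // IsL1 ν ψ ∧ IsConvex ψ},
    eint ν ψ.1 - eint μ (conj (conv (conj ψ.1) (gam d)))

end WeakMartingaleDuality

namespace WeakMartingaleDuality

open Filter Topology

/-! The core is the identity φ^ψ = (ψ* ∗ γ)* on all of C_q (`IsCq.phi_eq`). Write u = ψ*. For a
coupling (X, Z) with X of barycenter x and Z of law γ, Young's inequality ⟨X, y + Z⟩ ≤ ψ(X) + u(y +
Z) integrates to ⟨y, x⟩ - ∫ u(y + z) γ(dz) ≤ ∫ ψ dp - E⟨X, Z⟩; symmetry of γ turns the left side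
into ⟨y, x⟩ - (u ∗ γ)(y). Equality is reached by taking y to be a maximizer of the left side: its
first-order condition is ∫ ∇u(y - z) γ(dz) = x, so X = ∇u(y - Z'), coupled with Z = -Z', has
barycenter x, and Young's inequality is an equality along gradients.

With this identity both dual problems have the same objective, and only the classes of ψ differ.
From C_q to convex functions, replace ψ by ψ**, which is smaller and has the same conjugate
(`dual_le_dualTilde`). Conversely, a convex ψ in L¹(ν) is regularized by adding c|y|² to its
conjugate: the conjugate w of ψ* + c|·|² is finite, continuous, of quadratic growth, and w ≤ ψ** ≤
ψ. Then max(w, |x|²/2 - m) lies in C_q, and letting m → ∞ and then c → 0 recovers the value at ψ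
(`dualTilde_le_eint_sub`, `tendsto_eint_conj_add`). -/

theorem absolutelyContinuous_pi_fin : ∀ {n : ℕ} (μ ν : Fin n → Measure ℝ)
    [∀ i, SigmaFinite (μ i)] [∀ i, SigmaFinite (ν i)], (∀ i, μ i ≪ ν i) →
    Measure.pi μ ≪ Measure.pi ν
  | 0, μ, ν, _, _, _ => by
    rw [Measure.pi_of_empty μ, Measure.pi_of_empty ν]
  | n + 1, μ, ν, _, _, h => by
    have hμ := (measurePreserving_piFinSuccAbove μ 0).symm
    have hν := (measurePreserving_piFinSuccAbove ν 0).symm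
    rw [← hμ.map_eq, ← hν.map_eq]
    exact ((h 0).prod (absolutelyContinuous_pi_fin _ _ fun i => h _)).map hν.measurable

/-! ### Gaussian measure and finite second moments -/

variable {d : ℕ}

/-- Transfers Rademacher's theorem from Lebesgue measure to γ, so that ∇u(y - z) makes sense for
γ-almost every z. -/
theorem gam_absolutelyContinuous (d : ℕ) : gam d ≪ volume := by
  have h : (Measure.pi fun _ : Fin d => gaussianReal 0 1) ≪ volume := by
    rw [volume_pi]
    exact absolutelyContinuous_pi_fin _ _ fun _ => gaussianReal_absolutelyContinuous 0 one_ne_zero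
  have hv := PiLp.volume_preserving_toLp (Fin d)
  rw [gam, ← map_pi_eq_stdGaussian, ← hv.map_eq]
  exact h.map hv.measurable

theorem measurePreserving_neg_gam (d : ℕ) : MeasurePreserving (fun z => -z) (gam d) (gam d) :=
  ⟨measurable_neg, stdGaussian_map (LinearIsometryEquiv.neg ℝ : E d ≃ₗᵢ[ℝ] E d)⟩

theorem integrable_norm_sq_gam (d : ℕ) : Integrable (fun z => ‖z‖ ^ 2) (gam d) :=
  (IsGaussian.memLp_two_id (μ := gam d)).integrable_norm_pow two_ne_zero

theorem isP2_gam (d : ℕ) : IsP2 (gam d) := ⟨inferInstance, integrable_norm_sq_gam d⟩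

theorem IsP2.memLp {p : Measure (E d)} (hp : IsP2 p) : MemLp id 2 p :=
  (memLp_two_iff_integrable_sq_norm aestronglyMeasurable_id).2 hp.2

theorem IsP2.integrable_id {p : Measure (E d)} (hp : IsP2 p) : Integrable (fun x => x) p :=
  have := hp.1
  hp.memLp.integrable one_le_two

theorem IsP2.integrable_of_bound {p : Measure (E d)} (hp : IsP2 p) {f : E d → ℝ}
    (hf : Measurable f) {a b : ℝ} (h : ∀ x, |f x| ≤ a + b * ‖x‖ ^ 2) : Integrable f p := by
  have := hp.1
  exact ((integrable_const a).add (hp.2.const_mul b)).mono' hf.aestronglyMeasurable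
    (Eventually.of_forall h)

/-! ### The extended-valued integral -/

theorem eint_coe {p : Measure (E d)} {f : E d → ℝ} (hf : Integrable f p) :
    eint p (fun x => (f x : EReal)) = ((∫ x, f x ∂p : ℝ) : EReal) := by
  have h1 : ∫⁻ x, ENNReal.ofReal (f x) ∂p ≠ ⊤ := hf.lintegral_lt_top.ne
  have h2 : ∫⁻ x, ENNReal.ofReal (-f x) ∂p ≠ ⊤ := hf.neg.lintegral_lt_top.ne
  rw [integral_eq_lintegral_pos_part_sub_lintegral_neg_part hf, EReal.coe_sub, eint]
  simp only [← EReal.coe_neg, EReal.real_coe_toENNReal]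
  rw [EReal.coe_ennreal_toReal h1, EReal.coe_ennreal_toReal h2]

theorem eint_mono {p : Measure (E d)} {f g : E d → EReal} (h : ∀ x, f x ≤ g x) :
    eint p f ≤ eint p g :=
  EReal.sub_le_sub
    (EReal.coe_ennreal_le_coe_ennreal_iff.2
      (lintegral_mono fun x => EReal.toENNReal_le_toENNReal (h x)))
    (EReal.coe_ennreal_le_coe_ennreal_iff.2
      (lintegral_mono fun x => EReal.toENNReal_le_toENNReal (EReal.neg_le_neg_iff.2 (h x))))

/-- Addition of an integrable real function. -/
theorem eint_add_coe_le {p : Measure (E d)} {f : E d → EReal} {r : E d → ℝ} (hf : Measurable f)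
    (hneg : ∫⁻ x, (-f x).toENNReal ∂p ≠ ⊤) (hr : Integrable r p) :
    eint p (fun x => f x + r x) ≤ eint p f + ((∫ x, r x ∂p : ℝ) : EReal) := by
  by_cases hpos : ∫⁻ x, (f x).toENNReal ∂p = ⊤
  · have : eint p f = ⊤ := by
      rw [eint, hpos]
      lift ∫⁻ x, (-f x).toENNReal ∂p to NNReal using hneg with b
      rfl
    rw [this, EReal.top_add_coe]
    exact le_top
  have m1 : Measurable fun x => (f x).toENNReal := hf.ereal_toENNReal
  have m2 : Measurable fun x => (-f x).toENNReal := hf.neg.ereal_toENNReal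
  have hfin : ∀ᵐ x ∂p, f x = (((f x).toReal : ℝ) : EReal) := by
    filter_upwards [ae_lt_top m1 hpos, ae_lt_top m2 hneg] with x h1 h2
    rw [EReal.coe_toReal]
    · rintro h; simp [h] at h1
    · rintro h; simp [h] at h2
  have hint : Integrable (fun x => (f x).toReal) p := by
    have i1 := integrable_toReal_of_lintegral_ne_top m1.aemeasurable hpos
    have i2 := integrable_toReal_of_lintegral_ne_top m2.aemeasurable hneg
    refine (i1.sub i2).congr ?_
    filter_upwards [hfin] with x hx
    rw [Pi.sub_apply, hx]
    simp only [EReal.real_coe_toENNReal, EReal.toReal_coe, ← EReal.coe_neg]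
    rw [ENNReal.toReal_ofReal', ENNReal.toReal_ofReal']
    exact max_zero_sub_max_neg_zero_eq_self _
  have e1 : eint p f = eint p fun x => (((f x).toReal : ℝ) : EReal) := by
    unfold eint
    rw [lintegral_congr_ae (hfin.mono fun x hx => congrArg EReal.toENNReal hx),
      lintegral_congr_ae (hfin.mono fun x hx => congrArg (fun t => (-t).toENNReal) hx)]
  have e2 : eint p (fun x => f x + r x) = eint p fun x => (((f x).toReal + r x : ℝ) : EReal) := by
    unfold eint
    have h : ∀ᵐ x ∂p, f x + r x = (((f x).toReal + r x : ℝ) : EReal) := by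
      filter_upwards [hfin] with x hx
      rw [EReal.coe_add, ← hx]
    rw [lintegral_congr_ae (h.mono fun x hx => congrArg EReal.toENNReal hx),
      lintegral_congr_ae (h.mono fun x hx => congrArg (fun t => (-t).toENNReal) hx)]
  rw [e1, e2, eint_coe hint, eint_coe (f := fun x => (f x).toReal + r x) (hint.add hr),
    integral_add hint hr, EReal.coe_add]

theorem lintegral_neg_ne_top {p : Measure (E d)} {f : E d → EReal} {L : E d → ℝ}
    (hL : Integrable L p) (h : ∀ x, (L x : EReal) ≤ f x) : ∫⁻ x, (-f x).toENNReal ∂p ≠ ⊤ := by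
  refine ne_top_of_le_ne_top hL.neg.lintegral_lt_top.ne (lintegral_mono fun x => ?_)
  have := EReal.toENNReal_le_toENNReal (EReal.neg_le_neg_iff.2 (h x))
  rwa [← EReal.coe_neg, EReal.real_coe_toENNReal] at this

theorem eint_ne_bot {p : Measure (E d)} {f : E d → EReal} {L : E d → ℝ}
    (hL : Integrable L p) (h : ∀ x, (L x : EReal) ≤ f x) : eint p f ≠ ⊥ := by
  intro hb
  have := eint_mono (p := p) h
  rw [eint_coe hL, hb, le_bot_iff] at this
  exact EReal.coe_ne_bot _ this

/-- Monotone convergence for the extended integral. -/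
theorem tendsto_eint_of_monotone {p : Measure (E d)} {f : ℕ → E d → EReal} {g : E d → EReal}
    {L : E d → ℝ} (hL : Integrable L p) (hf : ∀ n, Measurable (f n))
    (hmono : ∀ x, Monotone fun n => f n x) (hLf : ∀ n x, (L x : EReal) ≤ f n x)
    (hlim : ∀ x, Tendsto (fun n => f n x) atTop (𝓝 (g x))) :
    Tendsto (fun n => eint p (f n)) atTop (𝓝 (eint p g)) := by
  have hLg : ∀ x, (L x : EReal) ≤ g x := fun x => ge_of_tendsto' (hlim x) fun n => hLf n x
  have h1 : Tendsto (fun n => ∫⁻ x, (f n x).toENNReal ∂p) atTop (𝓝 (∫⁻ x, (g x).toENNReal ∂p)) :=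
    lintegral_tendsto_of_tendsto_of_monotone (fun n => (hf n).ereal_toENNReal.aemeasurable)
      (Eventually.of_forall fun x _ _ h => EReal.toENNReal_le_toENNReal (hmono x h))
      (Eventually.of_forall fun x => (EReal.continuous_toENNReal.tendsto _).comp (hlim x))
  have h2 : Tendsto (fun n => ∫⁻ x, (-f n x).toENNReal ∂p) atTop
      (𝓝 (∫⁻ x, (-g x).toENNReal ∂p)) :=
    lintegral_tendsto_of_tendsto_of_antitone (fun n => (hf n).neg.ereal_toENNReal.aemeasurable)
      (Eventually.of_forall fun x _ _ h =>
        EReal.toENNReal_le_toENNReal (EReal.neg_le_neg_iff.2 (hmono x h)))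
      (lintegral_neg_ne_top hL (hLf 0))
      (Eventually.of_forall fun x =>
        ((EReal.continuous_toENNReal.comp continuous_neg).tendsto _).comp (hlim x))
  have hne := lintegral_neg_ne_top hL hLg
  unfold eint
  simp only [sub_eq_add_neg]
  refine (EReal.continuousAt_add (Or.inr ?_) ?_).tendsto.comp
    (Tendsto.prodMk_nhds ((continuous_coe_ennreal_ereal.tendsto _).comp h1)
      ((continuous_neg.tendsto _).comp ((continuous_coe_ennreal_ereal.tendsto _).comp h2)))
  · simpa [EReal.neg_eq_bot_iff] using hne
  · exact Or.inl (EReal.coe_ennreal_ne_bot _)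

/-! ### Real-valued convex conjugates -/

/-- A continuous function of at least quadratic growth has an attained conjugate. -/
theorem exists_forall_inner_sub_le {f : E d → ℝ} (hf : Continuous f) {b c : ℝ} (hc : 0 < c)
    (h : ∀ x, b + c * ‖x‖ ^ 2 ≤ f x) (y : E d) :
    ∃ x₀, ∀ x, inner ℝ x y - f x ≤ inner ℝ x₀ y - f x₀ := by
  refine Continuous.exists_forall_ge' (f := fun x => inner ℝ x y - f x) (by fun_prop) 0 ?_
  filter_upwards [(tendsto_norm_cocompact_atTop (E := E d)).eventually_ge_atTop
    ((‖y‖ + |f 0 - b|) / c + 1)] with x hx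
  have h1 : ‖y‖ + |f 0 - b| ≤ c * ‖x‖ := by
    have : (‖y‖ + |f 0 - b|) / c ≤ ‖x‖ := by linarith
    rwa [div_le_iff₀' hc] at this
  have h2 : 1 ≤ ‖x‖ := by
    have : 0 ≤ (‖y‖ + |f 0 - b|) / c := by positivity
    linarith
  have h3 := real_inner_le_norm x y
  have h4 := h x
  have h5 := le_abs_self (f 0 - b)
  have h6 : |f 0 - b| ≤ ‖x‖ * (c * ‖x‖ - ‖y‖) := by
    nlinarith [abs_nonneg (f 0 - b)]
  simp only [inner_zero_left, zero_sub]
  nlinarith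

theorem conj_coe_eq {f : E d → ℝ} {x₀ y : E d}
    (h : ∀ x, inner ℝ x y - f x ≤ inner ℝ x₀ y - f x₀) :
    conj (fun x => (f x : EReal)) y = ((inner ℝ x₀ y - f x₀ : ℝ) : EReal) := by
  refine le_antisymm (iSup_le fun x => ?_) (le_iSup_of_le x₀ ?_)
  · rw [← EReal.coe_sub]; exact_mod_cast h x
  · rw [← EReal.coe_sub]

theorem fderiv_eq_of_forall_inner_sub_le {f : E d → ℝ} {x y : E d} {L : E d →L[ℝ] ℝ}
    (hL : HasFDerivAt f L y) (h : ∀ z, inner ℝ x z - f z ≤ inner ℝ x y - f y) (v : E d) :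
    L v = inner ℝ x v := by
  have h1 : HasFDerivAt (fun z => inner ℝ x z - f z) (innerSL ℝ x - L) y :=
    (innerSL ℝ x).hasFDerivAt.sub hL
  have h2 : IsLocalMax (fun z => inner ℝ x z - f z) y := Eventually.of_forall h
  have h3 := congrArg (fun M : E d →L[ℝ] ℝ => M v) (h2.hasFDerivAt_eq_zero h1)
  simp only [_root_.sub_apply, innerSL_apply_apply, _root_.zero_apply] at h3
  linarith

/-- The properties of the conjugate `u` of a function `ψ` of quadratic growth. -/
structure IsLegendre (ψ u : E d → ℝ) : Prop where
  young : ∀ x y, inner ℝ x y ≤ ψ x + u y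
  attained : ∀ y, ∃ x, inner ℝ x y = ψ x + u y
  norm_le : ∃ C, 0 ≤ C ∧ ∀ x y, inner ℝ x y = ψ x + u y → ‖x‖ ≤ C + 2 * ‖y‖
  growth : ∃ A, ∀ y, |u y| ≤ A + 1 / 2 * ‖y‖ ^ 2
  coercive : ∃ b c, 0 < c ∧ ∀ y, b + c * ‖y‖ ^ 2 ≤ u y

/-- The quadratic lower bound on ψ makes the supremum attained and bounds u above; the quadratic
upper bound makes u coercive. -/
theorem IsCq.exists_isLegendre {ψ : E d → ℝ} (hψ : IsCq ψ) : ∃ u, IsLegendre ψ u := by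
  obtain ⟨hc, a, k, l, h⟩ := hψ
  have hmax := exists_forall_inner_sub_le hc (b := l) (c := 1 / 2) (by norm_num)
    (fun x => by linarith [(h x).1])
  choose X hX using hmax
  have hyoung : ∀ x y, inner ℝ x y ≤ ψ x + (inner ℝ (X y) y - ψ (X y)) := fun x y => by
    linarith [hX y x]
  have hal : l ≤ a := by
    have := h 0
    simp only [norm_zero] at this
    linarith
  have hup : ∀ y, inner ℝ (X y) y - ψ (X y) ≤ -l + 1 / 2 * ‖y‖ ^ 2 := fun y => by
    nlinarith [real_inner_le_norm (X y) y, (h (X y)).1, sq_nonneg (‖X y‖ - ‖y‖)]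
  have hlow : ∀ y, -a + 1 / (4 * max k 1) * ‖y‖ ^ 2 ≤ inner ℝ (X y) y - ψ (X y) := fun y => by
    have hK : (0 : ℝ) < max k 1 := lt_of_lt_of_le one_pos (le_max_right _ _)
    -- With K = max k 1, the point y/(2K) maximizes ⟨x, y⟩ - K|x|²; the maximum with 1 keeps K
    -- positive.
    have h1 := hyoung ((1 / (2 * max k 1)) • y) y
    have h2 := (h ((1 / (2 * max k 1)) • y)).2
    have h3 : k * ‖(1 / (2 * max k 1)) • y‖ ^ 2 ≤ max k 1 * ‖(1 / (2 * max k 1)) • y‖ ^ 2 :=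
      mul_le_mul_of_nonneg_right (le_max_left _ _) (sq_nonneg _)
    rw [real_inner_smul_left, real_inner_self_eq_norm_sq] at h1
    rw [norm_smul, mul_pow, Real.norm_eq_abs, sq_abs] at h2 h3
    have h4 : max k 1 * ((1 / (2 * max k 1)) ^ 2 * ‖y‖ ^ 2) = 1 / (4 * max k 1) * ‖y‖ ^ 2 := by
      field_simp; ring
    have h5 : 1 / (2 * max k 1) * ‖y‖ ^ 2 = 2 * (1 / (4 * max k 1) * ‖y‖ ^ 2) := by
      field_simp; ring
    linarith
  have hlow' : ∀ y, -a ≤ inner ℝ (X y) y - ψ (X y) := fun y => by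
    have : 0 ≤ 1 / (4 * max k 1) * ‖y‖ ^ 2 := by positivity
    linarith [hlow y]
  refine ⟨fun y => inner ℝ (X y) y - ψ (X y), hyoung, fun y => ⟨X y, by ring⟩,
    ⟨2 * (a - l + 1), by linarith, fun x y hxy => ?_⟩, ⟨|a| + |l|, fun y => ?_⟩,
    ⟨-a, 1 / (4 * max k 1), by positivity, hlow⟩⟩
  -- From -a ≤ u(y) = ⟨x, y⟩ - ψ(x) ≤ |x||y| - l - |x|²/2 follows |x|² ≤ 2|x||y| + 2(a - l).
  · refine abs_le_of_sq_le_sq' ?_ (by nlinarith [norm_nonneg y]) |>.2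
    have h1 := hlow' y
    have h2 := (h x).1
    have h3 := real_inner_le_norm x y
    nlinarith [sq_nonneg (‖x‖ - 2 * ‖y‖), norm_nonneg y, norm_nonneg x,
      mul_nonneg (sub_nonneg.2 hal) (norm_nonneg y), sq_nonneg (a - l)]
  · rw [abs_le]
    constructor
    · nlinarith [hlow' y, le_abs_self a, abs_nonneg l, sq_nonneg ‖y‖]
    · linarith [hup y, neg_abs_le l, abs_nonneg a]

namespace IsLegendre

variable {ψ u : E d → ℝ}

theorem conj_eq (h : IsLegendre ψ u) :
    conj (fun x => (ψ x : EReal)) = fun y => (u y : EReal) := by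
  funext y
  obtain ⟨x, hx⟩ := h.attained y
  rw [conj_coe_eq (x₀ := x) fun z => by linarith [h.young z y], hx, add_sub_cancel_left]

/-- A maximizer at y is a subgradient of u there, and its norm grows at most linearly in |y|. -/
theorem abs_sub_le (h : IsLegendre ψ u) : ∃ C, 0 ≤ C ∧ ∀ y z,
    |u y - u z| ≤ (C + 2 * ‖y‖ + 2 * ‖z‖) * ‖y - z‖ := by
  obtain ⟨C, hC, hn⟩ := h.norm_le
  have key : ∀ y z, u y - u z ≤ (C + 2 * ‖y‖ + 2 * ‖z‖) * ‖y - z‖ := fun y z => by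
    obtain ⟨x, hx⟩ := h.attained y
    have h1 := h.young x z
    have h2 : u y - u z ≤ inner ℝ x (y - z) := by rw [inner_sub_right]; linarith
    refine h2.trans ((real_inner_le_norm _ _).trans ?_)
    exact mul_le_mul_of_nonneg_right (by linarith [hn x y hx, norm_nonneg z]) (norm_nonneg _)
  refine ⟨C, hC, fun y z => abs_sub_le_iff.2 ⟨key y z, ?_⟩⟩
  have := key z y
  rw [norm_sub_rev] at this
  linarith

theorem continuous (h : IsLegendre ψ u) : Continuous u := by
  obtain ⟨C, hC, hu⟩ := h.abs_sub_le
  refine continuous_iff_continuousAt.2 fun y => tendsto_iff_norm_sub_tendsto_zero.2 ?_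
  refine squeeze_zero (fun _ => norm_nonneg _) (fun z => hu z y) ?_
  have : Continuous fun z : E d => (C + 2 * ‖z‖ + 2 * ‖y‖) * ‖z - y‖ := by fun_prop
  simpa using this.tendsto y

theorem ae_differentiableAt (h : IsLegendre ψ u) : ∀ᵐ y : E d, DifferentiableAt ℝ u y := by
  obtain ⟨C, hC, hu⟩ := h.abs_sub_le
  have hl : ∀ n : ℕ, LipschitzOnWith (C + 4 * n).toNNReal u (Metric.ball 0 n) := fun n =>
    LipschitzOnWith.of_dist_le_mul fun y hy z hz => by
      rw [mem_ball_zero_iff] at hy hz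
      rw [Real.coe_toNNReal _ (by positivity), dist_eq_norm, dist_eq_norm]
      exact (hu y z).trans (mul_le_mul_of_nonneg_right (by linarith) (norm_nonneg _))
  filter_upwards [ae_all_iff.2 fun n => (hl n).ae_differentiableWithinAt_of_mem (μ := volume)]
    with y hy
  obtain ⟨n, hn⟩ := exists_nat_gt ‖y‖
  have hmem : y ∈ Metric.ball (0 : E d) n := mem_ball_zero_iff.2 hn
  exact (hy n hmem).differentiableAt (Metric.isOpen_ball.mem_nhds hmem)

theorem integrable_sub (h : IsLegendre ψ u) (y : E d) :
    Integrable (fun z => u (y - z)) (gam d) := by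
  obtain ⟨A, hA⟩ := h.growth
  refine (isP2_gam d).integrable_of_bound (a := A + ‖y‖ ^ 2) (b := 1)
    (h.continuous.measurable.comp (measurable_const.sub measurable_id)) fun z => ?_
  nlinarith [hA (y - z), norm_sub_le y z, sq_nonneg (‖y‖ - ‖z‖), norm_nonneg (y - z),
    norm_nonneg y, norm_nonneg z]

theorem conv_eq (h : IsLegendre ψ u) : conv (fun y => (u y : EReal)) (gam d) =
    fun y => ((∫ z, u (y - z) ∂gam d : ℝ) : EReal) :=
  funext fun y => eint_coe (h.integrable_sub y)

/-- If x attains u(y), then z ↦ ⟨x, z⟩ - u(z) is maximal at y, so differentiability forces x =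
∇u(y). -/
theorem inner_gradient_eq (h : IsLegendre ψ u) {y : E d} (hy : DifferentiableAt ℝ u y) :
    inner ℝ (gradient u y) y = ψ (gradient u y) + u y := by
  obtain ⟨x, hx⟩ := h.attained y
  have : gradient u y = x := by
    refine ext_inner_right ℝ fun v => ?_
    rw [inner_gradient_left]
    exact fderiv_eq_of_forall_inner_sub_le hy.hasFDerivAt
      (fun z => by linarith [h.young x z]) v
  rw [this, hx]

theorem measurable_gradient (u : E d → ℝ) : Measurable (gradient u) :=
  (InnerProductSpace.toDual ℝ (E d)).symm.continuous.measurable.comp (measurable_fderiv ℝ u)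

theorem ae_gam_differentiableAt (h : IsLegendre ψ u) (y : E d) :
    ∀ᵐ z ∂gam d, DifferentiableAt ℝ u (y - z) :=
  (gam_absolutelyContinuous d).ae_le
    ((Measure.measurePreserving_sub_left volume y).quasiMeasurePreserving.ae h.ae_differentiableAt)

/-- Almost everywhere differentiability of u suffices: its local Lipschitz constant grows linearly
and is therefore γ-integrable, which dominates the difference quotients. -/
theorem hasFDerivAt_integral (h : IsLegendre ψ u) (y : E d) :
    HasFDerivAt (fun y => ∫ z, u (y - z) ∂gam d) (∫ z, fderiv ℝ u (y - z) ∂gam d) y ∧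
      Integrable (fun z => fderiv ℝ u (y - z)) (gam d) := by
  obtain ⟨C, hC, hu⟩ := h.abs_sub_le
  refine (hasFDerivAt_integral_of_dominated_loc_of_lip' (s := Metric.ball y 1)
    (F := fun y z => u (y - z)) (bound := fun z => C + 2 + 4 * ‖y‖ + 4 * ‖z‖)
    (Metric.ball_mem_nhds y one_pos) (fun x _ => (h.integrable_sub x).aestronglyMeasurable)
    (h.integrable_sub y) ?_ ?_ ?_ ?_).symm
  · exact ((measurable_fderiv ℝ u).comp
      (measurable_const.sub measurable_id)).aestronglyMeasurable
  · refine Eventually.of_forall fun z x hx => ?_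
    rw [mem_ball_iff_norm] at hx
    have h1 := hu (x - z) (y - z)
    rw [sub_sub_sub_cancel_right] at h1
    refine h1.trans (mul_le_mul_of_nonneg_right ?_ (norm_nonneg _))
    have h2 : ‖x‖ ≤ ‖y‖ + 1 := by
      have := norm_le_norm_add_norm_sub' x y
      linarith
    linarith [norm_sub_le x z, norm_sub_le y z]
  · exact (integrable_const _).add ((isP2_gam d).integrable_id.norm.const_mul 4)
  · filter_upwards [h.ae_gam_differentiableAt y] with z hz
    have : HasFDerivAt u (fderiv ℝ u (y - z)) (y - z) := hz.hasFDerivAt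
    simpa [Function.comp_def] using this.comp y ((hasFDerivAt_id y).sub_const z)

/-- Coercivity survives Gaussian averaging: |y - z|² ≥ |y|² - 2⟨y, z⟩, and the linear term vanishes
since γ is centred. -/
theorem exists_max (h : IsLegendre ψ u) (x : E d) : ∃ y₀, ∀ y,
    inner ℝ y x - ∫ z, u (y - z) ∂gam d ≤ inner ℝ y₀ x - ∫ z, u (y₀ - z) ∂gam d := by
  obtain ⟨b, c, hc, hb⟩ := h.coercive
  refine exists_forall_inner_sub_le (b := b) (c := c)
    (continuous_iff_continuousAt.2 fun y => (h.hasFDerivAt_integral y).1.continuousAt) hc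
    (fun y => ?_) x
  have hi : Integrable (fun z : E d => inner ℝ y z) (gam d) :=
    (isP2_gam d).integrable_id.const_inner y
  have h1 : ∫ z, (b + c * ‖y‖ ^ 2 - 2 * c * inner ℝ y z) ∂gam d = b + c * ‖y‖ ^ 2 := by
    rw [integral_sub (integrable_const _) (hi.const_mul _), integral_const_mul,
      integral_inner (isP2_gam d).integrable_id, integral_id_stdGaussian]
    simp
  rw [← h1]
  refine integral_mono ((integrable_const _).sub (hi.const_mul _)) (h.integrable_sub y)
    fun z => ?_
  have h2 := hb (y - z)
  rw [norm_sub_sq_real] at h2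
  simp only
  nlinarith [mul_nonneg hc.le (sq_nonneg ‖z‖)]

end IsLegendre

/-! ### Maximal covariance and the formula for φ^ψ -/

theorem IsCq.integrable {ψ : E d → ℝ} (hψ : IsCq ψ) {p : Measure (E d)} (hp : IsP2 p) :
    Integrable ψ p := by
  obtain ⟨hc, a, k, l, h⟩ := hψ
  refine hp.integrable_of_bound (a := |a| + |l|) (b := |k|) hc.measurable fun x => ?_
  have h1 := h x
  have h2 : k * ‖x‖ ^ 2 ≤ |k| * ‖x‖ ^ 2 :=
    mul_le_mul_of_nonneg_right (le_abs_self k) (sq_nonneg _)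
  have h3 : 0 ≤ |k| * ‖x‖ ^ 2 := by positivity
  rw [abs_le]
  constructor
  · linarith [neg_abs_le l, abs_nonneg a, sq_nonneg ‖x‖]
  · linarith [le_abs_self a, abs_nonneg l]

theorem IsCoupling.integrable_inner {p₁ p₂ : Measure (E d)} {q : Measure (E d × E d)}
    (hq : IsCoupling p₁ p₂ q) (h₁ : IsP2 p₁) (h₂ : IsP2 p₂) :
    Integrable (fun z : E d × E d => (inner ℝ z.1 z.2 : ℝ)) q := by
  obtain ⟨rfl, rfl⟩ := hq
  have i1 : Integrable (fun z : E d × E d => ‖z.1‖ ^ 2) q :=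
    h₁.2.comp_measurable measurable_fst
  have i2 : Integrable (fun z : E d × E d => ‖z.2‖ ^ 2) q :=
    h₂.2.comp_measurable measurable_snd
  refine (i1.add i2).mono' (by fun_prop) (Eventually.of_forall fun z => ?_)
  rw [Real.norm_eq_abs, Pi.add_apply]
  nlinarith [abs_real_inner_le_norm z.1 z.2, sq_nonneg (‖z.1‖ - ‖z.2‖), norm_nonneg z.1,
    norm_nonneg z.2, sq_nonneg ‖z.1‖]

namespace IsLegendre

variable {ψ u : E d → ℝ}

/-- Weak duality: integrate Young's inequality at (x₁, y + x₂) against an arbitrary coupling. -/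
theorem le_eint_sub_MCov (h : IsLegendre ψ u) (hψ : IsCq ψ) {x : E d} {p : Measure (E d)}
    (hp : IsP2At x p) (y : E d) :
    ((inner ℝ y x - ∫ z, u (y - z) ∂gam d : ℝ) : EReal) ≤
      eint p (fun x => (ψ x : EReal)) - MCov p (gam d) := by
  have := hp.1.1
  rw [eint_coe (hψ.integrable hp.1)]
  have key : MCov p (gam d) ≤
      ((∫ x, ψ x ∂p - (inner ℝ y x - ∫ z, u (y - z) ∂gam d) : ℝ) : EReal) := by
    refine iSup_le fun ⟨q, hq⟩ => EReal.coe_le_coe_iff.2 ?_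
    have hsub := (measurePreserving_neg_gam d).integral_comp
      (Homeomorph.neg (E d)).measurableEmbedding fun z => u (y - z)
    have hint : Integrable (fun z => u (y + z)) (gam d) := by
      have := (measurePreserving_neg_gam d).integrable_comp_of_integrable (h.integrable_sub y)
      simpa [Function.comp_def] using this
    simp only [sub_neg_eq_add] at hsub
    rw [← hsub]
    have i0 := hq.integrable_inner hp.1 (isP2_gam d)
    obtain ⟨h1, h2⟩ := hq
    have i1 : Integrable (fun z : E d × E d => ψ z.1) q := by
      have := hψ.integrable hp.1
      rw [← h1] at this
      exact this.comp_measurable measurable_fst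
    have i2 : Integrable (fun z : E d × E d => u (y + z.2)) q := by
      rw [← h2] at hint
      exact hint.comp_measurable measurable_snd
    have i3 : Integrable (fun z : E d × E d => z.1) q := by
      have := hp.1.integrable_id
      rw [← h1] at this
      exact this.comp_measurable measurable_fst
    have e1 : ∫ z, ψ z.1 ∂q = ∫ x, ψ x ∂p := by
      rw [← h1, integral_map measurable_fst.aemeasurable hψ.1.aestronglyMeasurable]
    have e2 : ∫ z, u (y + z.2) ∂q = ∫ z, u (y + z) ∂gam d := by
      have hc : Continuous fun z => u (y + z) := h.continuous.comp (continuous_const_add y)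
      rw [← h2, integral_map measurable_snd.aemeasurable hc.aestronglyMeasurable]
    have e3 : ∫ z, inner ℝ y z.1 ∂q = inner ℝ y x := by
      rw [integral_inner i3, ← hp.2, ← h1,
        integral_map measurable_fst.aemeasurable (by fun_prop)]
    calc ∫ z, inner ℝ z.1 z.2 ∂q
        ≤ ∫ z, (ψ z.1 + u (y + z.2) - inner ℝ y z.1) ∂q := by
          refine integral_mono i0 ((i1.add i2).sub (i3.const_inner y)) fun z => ?_
          have := h.young z.1 (y + z.2)
          rw [inner_add_right, real_inner_comm] at this
          simp only
          linarith
      _ = ∫ x, ψ x ∂p - (inner ℝ y x - ∫ z, u (y + z) ∂gam d) := by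
          rw [integral_sub (f := fun z : E d × E d => ψ z.1 + u (y + z.2)) (i1.add i2)
            (i3.const_inner y), integral_add i1 i2, e1, e2, e3]
          ring
  calc ((inner ℝ y x - ∫ z, u (y - z) ∂gam d : ℝ) : EReal)
      = ((∫ x, ψ x ∂p : ℝ) : EReal) -
          ((∫ x, ψ x ∂p - (inner ℝ y x - ∫ z, u (y - z) ∂gam d) : ℝ) : EReal) := by
        rw [← EReal.coe_sub, sub_sub_cancel]
    _ ≤ _ := EReal.sub_le_sub le_rfl key

/-- Strong duality: the law of ∇u(y - Z), coupled with -Z, is a competitor whose cost equals the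
dual value at the maximizer y. -/
theorem phi_le (h : IsLegendre ψ u) (hψ : IsCq ψ) {x y : E d}
    (hy : ∀ y', inner ℝ y' x - ∫ z, u (y' - z) ∂gam d ≤ inner ℝ y x - ∫ z, u (y - z) ∂gam d) :
    phi (fun x => (ψ x : EReal)) x ≤ ((inner ℝ y x - ∫ z, u (y - z) ∂gam d : ℝ) : EReal) := by
  obtain ⟨hD, hDint⟩ := h.hasFDerivAt_integral y
  set T : E d → E d := fun z => gradient u (y - z) with hT
  have mT : Measurable T := (measurable_gradient u).comp (measurable_const.sub measurable_id)
  have hY : ∀ᵐ z ∂gam d, inner ℝ (T z) (y - z) = ψ (T z) + u (y - z) := by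
    filter_upwards [h.ae_gam_differentiableAt y] with z hz using h.inner_gradient_eq hz
  obtain ⟨C, hC, hn⟩ := h.norm_le
  have hTn : ∀ᵐ z ∂gam d, ‖T z‖ ≤ C + 2 * ‖y‖ + 2 * ‖z‖ := by
    filter_upwards [hY] with z hz
    linarith [hn _ _ hz, norm_sub_le y z]
  have iT2 : Integrable (fun z => ‖T z‖ ^ 2) (gam d) := by
    refine ((integrable_const (2 * (C + 2 * ‖y‖) ^ 2)).add
      ((isP2_gam d).2.const_mul 8)).mono' (by fun_prop) ?_
    filter_upwards [hTn] with z hz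
    rw [Real.norm_eq_abs, abs_of_nonneg (sq_nonneg _), Pi.add_apply]
    nlinarith [norm_nonneg (T z), norm_nonneg z, norm_nonneg y,
      sq_nonneg (C + 2 * ‖y‖ - 2 * ‖z‖), pow_le_pow_left₀ (norm_nonneg (T z)) hz 2]
  have iT : Integrable T (gam d) := by
    refine (((integrable_const (C + 2 * ‖y‖)).add
      ((isP2_gam d).integrable_id.norm.const_mul 2))).mono' mT.aestronglyMeasurable ?_
    filter_upwards [hTn] with z hz using hz
  -- The barycenter constraint is the first-order condition at the maximizer y.
  have hbar : ∫ z, T z ∂gam d = x := by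
    refine ext_inner_left ℝ fun v => ?_
    rw [← integral_inner iT, real_inner_comm,
      ← fderiv_eq_of_forall_inner_sub_le hD
        (fun z => by simpa only [real_inner_comm] using hy z) v,
      ContinuousLinearMap.integral_apply hDint]
    exact integral_congr_ae (Eventually.of_forall fun z => inner_gradient_right)
  have hp : IsP2At x ((gam d).map T) := by
    refine ⟨⟨Measure.isProbabilityMeasure_map mT.aemeasurable, ?_⟩, ?_⟩
    · exact (integrable_map_measure (by fun_prop) mT.aemeasurable).2 iT2
    · rw [integral_map mT.aemeasurable (by fun_prop), hbar]
  have mq : Measurable fun z : E d => (T z, -z) := mT.prodMk measurable_neg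
  have hq : IsCoupling ((gam d).map T) (gam d) ((gam d).map fun z => (T z, -z)) := by
    constructor
    · rw [Measure.map_map measurable_fst mq]; rfl
    · rw [Measure.map_map measurable_snd mq]
      exact (measurePreserving_neg_gam d).map_eq
  have iψ : Integrable (fun z => ψ (T z)) (gam d) :=
    (hψ.integrable hp.1).comp_measurable mT
  have iq := hq.integrable_inner hp.1 (isP2_gam d)
  have iin : Integrable (fun z => (inner ℝ (T z) (-z) : ℝ)) (gam d) := iq.comp_measurable mq
  refine iInf_le_of_le ⟨_, hp⟩ ?_
  refine (EReal.sub_le_sub le_rfl (le_iSup _ ⟨_, hq⟩)).trans ?_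
  rw [eint_coe (hψ.integrable hp.1), ← EReal.coe_sub, EReal.coe_le_coe_iff,
    integral_map mT.aemeasurable hψ.1.aestronglyMeasurable,
    integral_map mq.aemeasurable (by fun_prop), ← integral_sub iψ iin, ← hbar,
    ← integral_inner iT, ← integral_sub (iT.const_inner y) (h.integrable_sub y)]
  refine (integral_congr_ae ?_).le
  filter_upwards [hY] with z hz
  rw [inner_sub_right] at hz
  rw [inner_neg_right, real_inner_comm (T z) y]
  linarith

end IsLegendre

/-- The transform `φ^ψ` is the conjugate of `ψ* ∗ γ`. -/
theorem IsCq.phi_eq {ψ : E d → ℝ} (hψ : IsCq ψ) :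
    phi (fun x => (ψ x : EReal)) =
      conj (conv (conj fun x => (ψ x : EReal)) (gam d)) := by
  obtain ⟨u, h⟩ := hψ.exists_isLegendre
  funext x
  obtain ⟨y, hy⟩ := h.exists_max x
  rw [h.conj_eq, h.conv_eq, conj_coe_eq hy]
  exact le_antisymm (h.phi_le hψ hy) (le_iInf fun p => h.le_eint_sub_MCov hψ p.2 y)

/-! ### Extended-real-valued convex conjugates -/

theorem coe_sub_le_of_coe_sub_le {r : ℝ} {a b : EReal} (h : (r : EReal) - a ≤ b) :
    (r : EReal) - b ≤ a := by
  induction a <;> induction b <;> simp_all [← EReal.coe_sub]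
  linarith

/-- A real limit of the minuend avoids ∞ - ∞, where subtraction is discontinuous. -/
theorem tendsto_sub_of_coe {α : Type*} {l : Filter α} {a b : α → EReal} {s : ℝ} {e : EReal}
    (ha : Tendsto a l (𝓝 (s : EReal))) (hb : Tendsto b l (𝓝 e)) :
    Tendsto (fun n => a n - b n) l (𝓝 ((s : EReal) - e)) := by
  simp only [sub_eq_add_neg]
  exact (EReal.continuousAt_add (p := ((s : EReal), -e)) (Or.inl (EReal.coe_ne_top s))
    (Or.inl (EReal.coe_ne_bot s))).tendsto.comp
    (Tendsto.prodMk_nhds ha ((continuous_neg.tendsto _).comp hb))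

theorem le_conj (f : E d → EReal) (x y : E d) :
    ((inner ℝ x y : ℝ) : EReal) - f x ≤ conj f y :=
  le_iSup (fun x : E d => ((inner ℝ x y : ℝ) : EReal) - f x) x

theorem conj_anti {f g : E d → EReal} (h : ∀ x, f x ≤ g x) (y : E d) : conj g y ≤ conj f y :=
  iSup_mono fun x => EReal.sub_le_sub le_rfl (h x)

theorem conj_conj_le (f : E d → EReal) (x : E d) : conj (conj f) x ≤ f x :=
  iSup_le fun y => coe_sub_le_of_coe_sub_le (by rw [real_inner_comm]; exact le_conj f x y)

theorem conj_conj_conj (f : E d → EReal) : conj (conj (conj f)) = conj f :=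
  funext fun y => le_antisymm (conj_conj_le _ y) (conj_anti (conj_conj_le f) y)

theorem continuous_coe_sub_const {r : E d → ℝ} (hr : Continuous r) (c : EReal) :
    Continuous fun y => (r y : EReal) - c := by
  induction c with
  | bot => simpa using continuous_const
  | coe c =>
    simp only [← EReal.coe_sub]
    exact continuous_coe_real_ereal.comp (hr.sub continuous_const)
  | top => simpa using continuous_const

theorem measurable_conj (f : E d → EReal) : Measurable (conj f) :=
  (lowerSemicontinuous_iSup fun x => (continuous_coe_sub_const
    (continuous_const.inner continuous_id) (f x)).lowerSemicontinuous).measurable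

theorem convex_epigraph_conj (f : E d → EReal) :
    Convex ℝ {z : E d × ℝ | conj f z.1 ≤ (z.2 : EReal)} := by
  have h : {z : E d × ℝ | conj f z.1 ≤ (z.2 : EReal)} =
      ⋂ x, {z : E d × ℝ | ((inner ℝ x z.1 : ℝ) : EReal) - f x ≤ (z.2 : EReal)} := by
    ext z
    simp [conj]
  rw [h]
  refine convex_iInter fun x => ?_
  generalize f x = c
  induction c with
  | bot => simpa using convex_empty
  | coe c =>
    simp only [← EReal.coe_sub, EReal.coe_le_coe_iff]
    intro z hz z' hz' a b ha hb hab
    simp only [Set.mem_ofPred_eq, Prod.fst_add, Prod.snd_add, Prod.smul_fst, Prod.smul_snd,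
      inner_add_right, real_inner_smul_right, smul_eq_mul] at *
    obtain rfl : b = 1 - a := by linarith
    nlinarith [mul_le_mul_of_nonneg_left hz ha, mul_le_mul_of_nonneg_left hz' hb]
  | top => simpa using convex_univ

theorem eint_top (p : Measure (E d)) [IsProbabilityMeasure p] : eint p (fun _ => ⊤) = ⊤ := by
  simp [eint]

theorem eint_bot (p : Measure (E d)) [IsProbabilityMeasure p] : eint p (fun _ => ⊥) = ⊥ := by
  simp [eint]

theorem IsL1.exists_eint_eq {p : Measure (E d)} {f : E d → EReal} (hf : IsL1 p f) :
    ∃ s : ℝ, eint p f = s := by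
  obtain ⟨-, h1, h2⟩ := hf
  exact ⟨_, by rw [eint, ← EReal.coe_ennreal_toReal h1.ne, ← EReal.coe_ennreal_toReal h2.ne,
    ← EReal.coe_sub]⟩

/-! ### Comparison of the two dual values -/

theorem dual_le_dualTilde (μ : Measure (E d)) {ν : Measure (E d)} (hν : IsP2 ν) :
    dual μ ν ≤ dualTilde μ ν := by
  have := hν.1
  refine le_iInf fun ⟨ψ, hψ⟩ => ?_
  obtain ⟨u, hu⟩ := hψ.exists_isLegendre
  have hlow : ∀ x, ((-u 0 : ℝ) : EReal) ≤ conj (conj fun x => (ψ x : EReal)) x := fun x => by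
    have := le_conj (conj fun x => (ψ x : EReal)) 0 x
    rw [inner_zero_left, hu.conj_eq, ← EReal.coe_sub, zero_sub] at this
    rwa [hu.conj_eq]
  have hle := conj_conj_le fun x => (ψ x : EReal)
  refine iInf_le_of_le ⟨conj (conj fun x => (ψ x : EReal)),
    ⟨(measurable_conj _).aemeasurable, ?_, ?_⟩, fun x hx => ?_, convex_epigraph_conj _⟩ ?_
  · refine (lintegral_mono fun x => EReal.toENNReal_le_toENNReal (hle x)).trans_lt ?_
    exact (hψ.integrable hν).lintegral_lt_top
  · exact (lintegral_neg_ne_top (integrable_const _) hlow).lt_top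
  · have := hlow x
    rw [hx, le_bot_iff] at this
    exact EReal.coe_ne_bot _ this
  · refine EReal.sub_le_sub (eint_mono hle) ?_
    rw [conj_conj_conj, hψ.phi_eq]

/-- Conjugates of `F + c ‖·‖²` are continuous and of quadratic growth. -/
theorem exists_conj_add_eq_coe {F : E d → EReal} {x₀ y₁ : E d} {r s c : ℝ} (hc : 0 < c)
    (hlow : ∀ y, ((inner ℝ x₀ y - r : ℝ) : EReal) ≤ F y) (hF : F y₁ = s) :
    ∃ w : E d → ℝ, Continuous w ∧
      (conj fun y => F y + ((c * ‖y‖ ^ 2 : ℝ) : EReal)) = (fun x => (w x : EReal)) ∧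
      (∀ x, inner ℝ y₁ x - (s + c * ‖y₁‖ ^ 2) ≤ w x) ∧
      ∀ x, w x ≤ ‖x - x₀‖ ^ 2 / (4 * c) + r := by
  set W := conj fun y => F y + ((c * ‖y‖ ^ 2 : ℝ) : EReal) with hW
  have h1 : ∀ x, ((inner ℝ y₁ x - (s + c * ‖y₁‖ ^ 2) : ℝ) : EReal) ≤ W x := fun x => by
    refine le_trans ?_ (le_conj _ y₁ x)
    rw [hF, ← EReal.coe_add, ← EReal.coe_sub]
  have h2 : ∀ x, W x ≤ ((‖x - x₀‖ ^ 2 / (4 * c) + r : ℝ) : EReal) := fun x => by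
    -- The affine minorant of F reduces this to the supremum over t = ‖y‖ of t‖x - x₀‖ - ct² + r.
    refine iSup_le fun y => ?_
    refine (EReal.sub_le_sub le_rfl (add_le_add_left (hlow y) _)).trans ?_
    rw [← EReal.coe_add, ← EReal.coe_sub, EReal.coe_le_coe_iff]
    have h3 : inner ℝ y x - inner ℝ x₀ y ≤ ‖y‖ * ‖x - x₀‖ := by
      rw [real_inner_comm y x₀, ← inner_sub_right]
      exact real_inner_le_norm _ _
    have h4 : ‖y‖ * ‖x - x₀‖ ≤ ‖x - x₀‖ ^ 2 / (4 * c) + c * ‖y‖ ^ 2 := by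
      have h5 : ‖x - x₀‖ ^ 2 / (4 * c) + c * ‖y‖ ^ 2 - ‖y‖ * ‖x - x₀‖ =
          (‖x - x₀‖ - 2 * c * ‖y‖) ^ 2 / (4 * c) := by
        field_simp; ring
      have : 0 ≤ (‖x - x₀‖ - 2 * c * ‖y‖) ^ 2 / (4 * c) := by positivity
      linarith
    linarith
  have hw : ∀ x, W x = ((W x).toReal : EReal) := fun x =>
    (EReal.coe_toReal (fun h => by have := h2 x; rw [h, top_le_iff] at this;
                                   exact EReal.coe_ne_top _ this)
      (fun h => by have := h1 x; rw [h, le_bot_iff] at this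
                   exact EReal.coe_ne_bot _ this)).symm
  have hconv : ConvexOn ℝ Set.univ fun x => (W x).toReal := by
    rw [convexOn_iff_convex_epigraph]
    convert convex_epigraph_conj fun y => F y + ((c * ‖y‖ ^ 2 : ℝ) : EReal) using 1
    ext z
    simp only [Set.mem_univ, true_and, Set.mem_ofPred_eq, ← hW]
    rw [hw z.1, EReal.coe_le_coe_iff, EReal.toReal_coe]
  refine ⟨fun x => (W x).toReal, ?_, funext hw, fun x => ?_, fun x => ?_⟩
  · exact continuousOn_univ.1 (hconv.continuousOn isOpen_univ)
  · exact EReal.coe_le_coe_iff.1 ((h1 x).trans_eq (hw x))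
  · exact EReal.coe_le_coe_iff.1 ((hw x).symm.trans_le (h2 x))

/-- The truncation supplies the lower bound ½|x|² + ℓ required in C_q, which w itself need not
satisfy. -/
theorem isCq_max {w : E d → ℝ} (hw : Continuous w) {a k : ℝ} (hk : 0 ≤ k)
    (h : ∀ x, w x ≤ a + k * ‖x‖ ^ 2) (m : ℕ) : IsCq fun x => max (w x) (‖x‖ ^ 2 / 2 - m) := by
  refine ⟨by fun_prop, |a|, k + 1 / 2, -m, fun x => ⟨?_, max_le ?_ ?_⟩⟩
  · exact le_trans (by linarith) (le_max_right _ _)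
  · nlinarith [h x, le_abs_self a, sq_nonneg ‖x‖]
  · have : 0 ≤ k * ‖x‖ ^ 2 := by positivity
    have : (0 : ℝ) ≤ m := m.cast_nonneg
    linarith [abs_nonneg a]

theorem tendsto_integral_max {ν : Measure (E d)} (hν : IsP2 ν) {w : E d → ℝ}
    (hw : Continuous w) (hi : Integrable w ν) :
    Tendsto (fun m : ℕ => ∫ x, max (w x) (‖x‖ ^ 2 / 2 - m) ∂ν) atTop (𝓝 (∫ x, w x ∂ν)) := by
  refine tendsto_integral_of_dominated_convergence (fun x => |w x| + ‖x‖ ^ 2)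
    (fun m => by fun_prop) (hi.abs.add hν.2) (fun m => Eventually.of_forall fun x => ?_)
    (Eventually.of_forall fun x => ?_)
  · have hm : (0 : ℝ) ≤ m := m.cast_nonneg
    rw [Real.norm_eq_abs, abs_le]
    constructor
    · refine le_trans ?_ (le_max_left _ _)
      linarith [neg_abs_le (w x), sq_nonneg ‖x‖]
    · exact max_le (by linarith [le_abs_self (w x), sq_nonneg ‖x‖])
        (by linarith [abs_nonneg (w x), sq_nonneg ‖x‖])
  · obtain ⟨n, hn⟩ := exists_nat_ge (‖x‖ ^ 2 / 2 - w x)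
    refine tendsto_const_nhds.congr' ?_
    filter_upwards [eventually_ge_atTop n] with m hm
    have : (n : ℝ) ≤ m := by exact_mod_cast hm
    rw [max_eq_left (by linarith)]

theorem integrable_norm_sub_sq (y : E d) : Integrable (fun z => ‖y - z‖ ^ 2) (gam d) := by
  refine (isP2_gam d).integrable_of_bound (a := 2 * ‖y‖ ^ 2) (b := 2) (by fun_prop) fun z => ?_
  rw [abs_of_nonneg (sq_nonneg _)]
  nlinarith [norm_sub_le y z, norm_nonneg (y - z), sq_nonneg (‖y‖ - ‖z‖), norm_nonneg y,
    norm_nonneg z]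

theorem integrable_inner_sub_sub (x y : E d) (r : ℝ) :
    Integrable (fun z => inner ℝ x (y - z) - r) (gam d) :=
  (((integrable_const y).sub (isP2_gam d).integrable_id).const_inner x).sub (integrable_const r)

/-- Regularizing ψ through its conjugate costs only the term c|·|² ∗ γ inside the outer conjugate,
while the ν-integral does not increase. -/
theorem dualTilde_le_eint_sub {μ ν : Measure (E d)} (hν : IsP2 ν) {ψ : E d → EReal}
    {x₀ y₁ : E d} {r s c : ℝ} (hc : 0 < c)
    (hlow : ∀ y, ((inner ℝ x₀ y - r : ℝ) : EReal) ≤ conj ψ y) (hF : conj ψ y₁ = s) :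
    dualTilde μ ν ≤ eint ν ψ - eint μ (conj fun y => conv (conj ψ) (gam d) y +
      ((c * ∫ z, ‖y - z‖ ^ 2 ∂gam d : ℝ) : EReal)) := by
  obtain ⟨w, hw, hWw, hlo, hup⟩ := exists_conj_add_eq_coe hc hlow hF
  have hup' : ∀ x, w x ≤ (‖x₀‖ ^ 2 / (2 * c) + r) + 1 / (2 * c) * ‖x‖ ^ 2 := fun x => by
    have h1 : ‖x - x₀‖ ^ 2 ≤ 2 * ‖x‖ ^ 2 + 2 * ‖x₀‖ ^ 2 := by
      nlinarith [norm_sub_le x x₀, norm_nonneg (x - x₀), sq_nonneg (‖x‖ - ‖x₀‖),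
        norm_nonneg x, norm_nonneg x₀]
    have h2 : ‖x - x₀‖ ^ 2 / (4 * c) ≤ (2 * ‖x‖ ^ 2 + 2 * ‖x₀‖ ^ 2) / (4 * c) := by gcongr
    have h3 : (2 * ‖x‖ ^ 2 + 2 * ‖x₀‖ ^ 2) / (4 * c) =
        ‖x₀‖ ^ 2 / (2 * c) + 1 / (2 * c) * ‖x‖ ^ 2 := by field_simp; ring
    linarith [hup x]
  have hk : 0 ≤ 1 / (2 * c) := by positivity
  have hi : Integrable w ν := by
    refine hν.integrable_of_bound
      (a := |‖x₀‖ ^ 2 / (2 * c) + r| + |s + c * ‖y₁‖ ^ 2| + ‖y₁‖ ^ 2) (b := 1 / (2 * c) + 1)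
      hw.measurable fun x => ?_
    have h1 : 0 ≤ 1 / (2 * c) * ‖x‖ ^ 2 := by positivity
    have h2 := (abs_le.1 (abs_real_inner_le_norm y₁ x)).1
    have h3 : ‖y₁‖ * ‖x‖ ≤ ‖y₁‖ ^ 2 + ‖x‖ ^ 2 := by
      nlinarith [sq_nonneg (‖y₁‖ - ‖x‖), norm_nonneg y₁, norm_nonneg x,
        mul_nonneg (norm_nonneg y₁) (norm_nonneg x)]
    rw [abs_le]
    constructor
    · linarith [hlo x, le_abs_self (s + c * ‖y₁‖ ^ 2), abs_nonneg (‖x₀‖ ^ 2 / (2 * c) + r)]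
    · linarith [hup' x, le_abs_self (‖x₀‖ ^ 2 / (2 * c) + r), abs_nonneg (s + c * ‖y₁‖ ^ 2),
        sq_nonneg ‖x‖, sq_nonneg ‖y₁‖]
  have hm : ∀ m : ℕ, dualTilde μ ν ≤ ((∫ x, max (w x) (‖x‖ ^ 2 / 2 - m) ∂ν : ℝ) : EReal) -
      eint μ (conj fun y => conv (conj ψ) (gam d) y +
        ((c * ∫ z, ‖y - z‖ ^ 2 ∂gam d : ℝ) : EReal)) := fun m => by
    have hχ := isCq_max hw hk hup' m
    refine iInf_le_of_le ⟨_, hχ⟩ ?_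
    simp only
    rw [eint_coe (hχ.integrable hν), hχ.phi_eq]
    refine EReal.sub_le_sub le_rfl (eint_mono fun x => conj_anti (fun y => ?_) x)
    -- The bound is uniform in m, so m → ∞ affects only the ν-integral.
    have hconj : ∀ y, conj (fun x => ((max (w x) (‖x‖ ^ 2 / 2 - m) : ℝ) : EReal)) y ≤
        conj ψ y + ((c * ‖y‖ ^ 2 : ℝ) : EReal) := fun y => by
      refine (conj_anti (f := fun x => (w x : EReal))
        (fun x => EReal.coe_le_coe_iff.2 (le_max_left _ _)) y).trans ?_
      rw [← hWw]
      exact conj_conj_le _ y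
    rw [← integral_const_mul]
    refine (eint_mono fun z => hconj (y - z)).trans
      (eint_add_coe_le ((measurable_conj ψ).comp (measurable_const.sub measurable_id)) ?_
        ((integrable_norm_sub_sq y).const_mul c))
    exact lintegral_neg_ne_top (integrable_inner_sub_sub x₀ y r) fun z => hlow (y - z)
  refine (ge_of_tendsto' (tendsto_sub_of_coe ((continuous_coe_real_ereal.tendsto _).comp
    (tendsto_integral_max hν hw hi)) tendsto_const_nhds) hm).trans ?_
  refine EReal.sub_le_sub ?_ le_rfl
  rw [← eint_coe hi]
  refine eint_mono fun x => ?_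
  rw [← congrFun hWw x]
  refine (conj_anti (f := conj ψ) (fun y => ?_) x).trans (conj_conj_le ψ x)
  exact le_add_of_nonneg_right (EReal.coe_nonneg.2 (by positivity))

/-- Adding small multiples of a nonnegative function `K` changes the integral of the conjugate by
an arbitrarily small amount. -/
theorem tendsto_eint_conj_add {μ : Measure (E d)} (hμ : IsP2 μ) {G : E d → EReal} {K : E d → ℝ}
    (hK : ∀ y, 0 ≤ K y) {y₀ : E d} {g : ℝ} (hG : G y₀ = g) :
    Tendsto (fun n : ℕ => eint μ (conj fun y => G y + ((1 / ((n : ℝ) + 1) * K y : ℝ) : EReal)))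
      atTop (𝓝 (eint μ (conj G))) := by
  have := hμ.1
  have hmono : ∀ x, Monotone fun n : ℕ =>
      conj (fun y => G y + ((1 / ((n : ℝ) + 1) * K y : ℝ) : EReal)) x := fun x m n hmn => by
    refine conj_anti (fun y => add_le_add_right (EReal.coe_le_coe_iff.2 ?_) _) x
    exact mul_le_mul_of_nonneg_right (Nat.one_div_le_one_div hmn) (hK y)
  refine tendsto_eint_of_monotone (L := fun x => inner ℝ y₀ x - (g + K y₀))
    ((hμ.integrable_id.const_inner y₀).sub (integrable_const _)) (fun n => measurable_conj _)
    hmono (fun n x => ?_) fun x => ?_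
  · refine le_trans ?_ (hmono x (Nat.zero_le n))
    refine le_trans ?_ (le_conj _ y₀ x)
    rw [hG, ← EReal.coe_add, ← EReal.coe_sub]
    simp
  · convert tendsto_atTop_iSup (hmono x) using 2
    -- The supremum over n commutes with the supremum over y, and for fixed y the penalty tends to
    -- 0.
    refine le_antisymm (iSup_le fun y => ?_) (iSup_le fun n => conj_anti (fun y => ?_) x)
    · refine le_of_tendsto' (f := fun n : ℕ => ((inner ℝ y x : ℝ) : EReal) -
        (G y + ((1 / ((n : ℝ) + 1) * K y : ℝ) : EReal))) (x := atTop) ?_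
        fun n => le_iSup_of_le n
          (le_conj (fun y => G y + ((1 / ((n : ℝ) + 1) * K y : ℝ) : EReal)) y x)
      refine tendsto_sub_of_coe tendsto_const_nhds ?_
      have h0 : Tendsto (fun n : ℕ => ((1 / ((n : ℝ) + 1) * K y : ℝ) : EReal)) atTop
          (𝓝 ((0 : ℝ) : EReal)) := by
        refine (continuous_coe_real_ereal.tendsto _).comp ?_
        simpa using tendsto_one_div_add_atTop_nhds_zero_nat.mul_const (K y)
      have := (EReal.continuousAt_add (p := (G y, ((0 : ℝ) : EReal)))
        (Or.inr (EReal.coe_ne_bot 0)) (Or.inr (EReal.coe_ne_top 0))).tendsto.comp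
        (Tendsto.prodMk_nhds tendsto_const_nhds h0)
      simpa [Function.comp_def] using this
    · exact le_add_of_nonneg_right
        (EReal.coe_nonneg.2 (mul_nonneg (by positivity) (hK y)))

theorem dualTilde_le_dual {μ ν : Measure (E d)} (hμ : IsP2 μ) (hν : IsP2 ν) :
    dualTilde μ ν ≤ dual μ ν := by
  have := hμ.1
  have := hν.1
  refine le_iInf fun ⟨ψ, hL, hbot, _⟩ => ?_
  obtain ⟨S, hS⟩ := hL.exists_eint_eq
  obtain ⟨x₀, hx₀⟩ := (ae_lt_top' hL.1.ereal_toENNReal hL.2.1.ne).exists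
  obtain ⟨r, hr⟩ : ∃ r : ℝ, ψ x₀ = r :=
    ⟨_, (EReal.coe_toReal (fun h => by simp [h] at hx₀) (hbot x₀)).symm⟩
  have hlow : ∀ y, ((inner ℝ x₀ y - r : ℝ) : EReal) ≤ conj ψ y := fun y => by
    have := le_conj ψ x₀ y
    rwa [hr, ← EReal.coe_sub] at this
  simp only
  rw [hS]
  -- Here the outer conjugate is identically ⊥, so the objective at ψ is ⊤ and there is nothing to
  -- prove.
  by_cases hG : ∀ y, conv (conj ψ) (gam d) y = ⊤
  · have : conj (conv (conj ψ) (gam d)) = fun _ => ⊥ := funext fun x => by simp [conj, hG]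
    rw [this, eint_bot, EReal.coe_sub_bot]
    exact le_top
  push Not at hG
  obtain ⟨y₀, hy₀⟩ := hG
  have hGbot : ∀ y, conv (conj ψ) (gam d) y ≠ ⊥ := fun y =>
    eint_ne_bot (integrable_inner_sub_sub x₀ y r) fun z => hlow (y - z)
  obtain ⟨y₁, hy₁⟩ : ∃ y, conj ψ y ≠ ⊤ := by
    by_contra! h
    refine hy₀ ?_
    simp only [conv, h]
    exact eint_top _
  have hy₁' : conj ψ y₁ ≠ ⊥ := fun h => by
    have := hlow y₁
    rw [h, le_bot_iff] at this
    exact EReal.coe_ne_bot _ this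
  have hlim := tendsto_eint_conj_add hμ (K := fun y => ∫ z, ‖y - z‖ ^ 2 ∂gam d)
    (fun y => integral_nonneg fun z => sq_nonneg _)
    (EReal.coe_toReal hy₀ (hGbot y₀)).symm
  -- The regularization parameter is c = 1/(n + 1), sent to 0.
  refine ge_of_tendsto' (tendsto_sub_of_coe tendsto_const_nhds hlim) fun n => ?_
  rw [← hS]
  exact dualTilde_le_eint_sub hν (by positivity) hlow (EReal.coe_toReal hy₁ hy₁').symm

end WeakMartingaleDuality

theorem proposition4p1 (d : ℕ) (μ ν : MeasureTheory.Measure (WeakMartingaleDuality.E d))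
    (hμ : WeakMartingaleDuality.IsP2 μ) (hν : WeakMartingaleDuality.IsP2 ν)
    (hμν : WeakMartingaleDuality.ConvexOrder μ ν) :
    WeakMartingaleDuality.dualTilde μ ν = WeakMartingaleDuality.dual μ ν ∧
      ∀ ψ : WeakMartingaleDuality.E d → ℝ,
        WeakMartingaleDuality.IsCq ψ → ConvexOn ℝ Set.univ ψ →
          ∀ x, WeakMartingaleDuality.phi (fun y => (ψ y : EReal)) x =
            WeakMartingaleDuality.conj
              (WeakMartingaleDuality.conv
                (WeakMartingaleDuality.conj (fun y => (ψ y : EReal)))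
                (WeakMartingaleDuality.gam d)) x :=
  ⟨le_antisymm (WeakMartingaleDuality.dualTilde_le_dual hμ hν)
    (WeakMartingaleDuality.dual_le_dualTilde μ hν),
    fun _ hψ _ x => congrFun hψ.phi_eq x⟩
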